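/- Let $N,T$ be natural numbers and consider $N$ clients over rounds $t=0,\dots,T-1$. Fix a payment $R\ge 0$ and a conservation rate $\theta\in[0,1]$, not both zero, and for each client $k$ unit costs $\alpha_k>0$, $\beta_k\ge 0$ and an initial buffer volume $D_k^0\ge 0$, with $\sum_{k=1}^N D_k^0>0$. A strategy $\Delta_k=(\Delta_k(0),\dots,\Delta_k(T-1))$ with $\Delta_k(t)\ge 0$ produces buffer volumes $D_k(0)=D_k^0$, $D_k(t+1)=\theta D_k(t)+\Delta_k(t)$. For a given mean-field estimator $\varphi(t)>0$ $(0\le t\le T-1)$ of the total volume, $\Delta_k$ is called optimal for client $k$ if it maximizes $$\sum_{t=0}^{T-1}\Big(\frac{D_k(t)}{\varphi(t)}R-\alpha_k\Delta_k(t)^2-\beta_kD_k(t)^2\Big)$$ among all nonnegative strategies. For a matrix $D=(D_k(t))$ with $\sum_iD_i(t)>0$ for all $t$, let $\Psi(D)$ be the matrix of volumes produced by the increments $$\Delta_k(t)=\Big[\frac1{2\alpha_k}\sum_{\tau=t+1}^{T-1}\theta^{\tau-t-1}\Big(\frac{R}{\sum_{i=1}^ND_i(\tau)}-2\beta_kD_k(\tau)\Big)\Big]^+,$$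 where $[x]^+=\max\{x,0\}$ (so that $\Delta_k(T-1)=0$). Then the mean-field estimator has a fixed point: there is $\varphi$ with $\varphi(t)>0$ for all $t=0,\dots,T-1$ such that, when all clients play optimal strategies for $\varphi$, the resulting volumes satisfy $\sum_{k=1}^N D_k(t)=\varphi(t)$ for all $t$. Moreover, $\varphi(t)=\sum_{k=1}^N D_k(t)$ for a matrix $D\in[0,U]^{NT}$ (for some sufficiently large capacity $U$) with $\Psi(D)=D$, and for each client $k$ the increments displayed above, computed from this $D$, form an optimal strategy for $\varphi$. -/

import Mathlib

open scoped BigOperators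

noncomputable section

namespace DUFL

/-- The data of the clients' stage of the game with `N` clients: the server's payment `R` per round,
the conservation rate `θ`, the unit costs `α k` (data collection) and `β k` (training), and the
initial buffered data volumes `D₀ k`. -/
structure Params (N : ℕ) where
  R : ℝ
  θ : ℝ
  α : Fin N → ℝ
  β : Fin N → ℝ
  D₀ : Fin N → ℝ

variable {N T : ℕ}

/-- The buffered volume at round `t` under the update rule `D (t + 1) = θ * D t + Δ t`,
started at `d₀`. Only the values at rounds `t < T` are used below. -/
def volume (θ d₀ : ℝ) (Δ : Fin T → ℝ) : ℕ → ℝ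
  | 0 => d₀
  | t + 1 => θ * volume θ d₀ Δ t + if h : t < T then Δ ⟨t, h⟩ else 0

/-- The utility of client `k` over the rounds `0, …, T - 1` when it plays `Δ` and the total volume
of all clients is estimated by `φ`. -/
def utility (p : Params N) (φ : Fin T → ℝ) (k : Fin N) (Δ : Fin T → ℝ) : ℝ :=
  ∑ t : Fin T, (volume p.θ (p.D₀ k) Δ t / φ t * p.R
    - p.α k * Δ t ^ 2 - p.β k * volume p.θ (p.D₀ k) Δ t ^ 2)

/-- `Δ` is an optimal data update strategy of client `k` for the estimator `φ`: it maximizes the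
utility among all strategies with nonnegative collection volumes. -/
def IsOptimalStrategy (p : Params N) (φ : Fin T → ℝ) (k : Fin N) (Δ : Fin T → ℝ) : Prop :=
  IsMaxOn (utility p φ k) {Δ' | ∀ t, 0 ≤ Δ' t} Δ ∧ ∀ t, 0 ≤ Δ t

/-- The estimator `φ` is a fixed point: when all clients play optimal strategies for `φ`, the
total buffered volume that results is `φ` again. -/
def IsFixedEstimator (p : Params N) (φ : Fin T → ℝ) : Prop :=
  ∃ Δ : Fin N → Fin T → ℝ, (∀ k, IsOptimalStrategy p φ k (Δ k)) ∧
    ∀ t : Fin T, φ t = ∑ k, volume p.θ (p.D₀ k) (Δ k) t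

/-- The increment formula `[1 / (2 α_k) ∑_{τ = t + 1}^{T - 1} θ^{τ - t - 1} (R / φ(τ) - 2 β_k d(τ))]⁺`.
For `t = T - 1` the sum is empty and the value is `0`. -/
def increment (p : Params N) (φ : Fin T → ℝ) (k : Fin N) (d : Fin T → ℝ) (t : Fin T) : ℝ :=
  max (1 / (2 * p.α k) * ∑ τ ∈ Finset.Ioi t,
    p.θ ^ ((τ : ℕ) - (t : ℕ) - 1) * (p.R / φ τ - 2 * p.β k * d τ)) 0

/-- The total volume of all clients at each round, for a matrix `D` of buffered volumes. -/
def total (D : Fin N → Fin T → ℝ) (t : Fin T) : ℝ := ∑ k, D k t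

/-- The map on volume matrices: the increments are computed from `D`, with the estimator
replaced by the total volume of `D`, and then inserted into the update rule. -/
def Psi (p : Params N) (D : Fin N → Fin T → ℝ) : Fin N → Fin T → ℝ :=
  fun k t => volume p.θ (p.D₀ k) (increment p (total D) k (D k)) t

end DUFL

end

/-!
The fixed point is found by maximization; no topological fixed point theorem is needed.

Write `D k` for the volumes produced by the strategy `Δ k`. For fixed `φ`, the derivative of the
utility of client `k` in the variable `Δ k t` is `marginalGain t - 2 α_k Δ k t`, where
`marginalGain t = ∑_{τ > t} θ ^ (τ - t - 1) (R / φ τ - 2 β_k D k τ)`. The utility is concave, so the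
condition `Δ k t = [marginalGain t / (2 α_k)]⁺` is sufficient for optimality
(`isOptimalStrategy_of_eq_increment`).

If `φ` is replaced by the total volume, these derivatives are the partial derivatives of a single
function, the potential `∑_t R log (∑_k D k t) - ∑_k ∑_t (α_k (Δ k t)² + β_k (D k t)²)`. Its
exponential is continuous even where a total volume vanishes, so it has a maximizer on a box
`[0, B]^{NT}` (`exists_potential_maximizer`). All totals are positive there, because for `R > 0`
the exponential vanishes wherever a total does, and for `θ > 0` the initial volume never dies out.
The first order conditions (`potential_variational_inequality`) then give the increment formula
(`eq_increment_of_variational_inequality`), provided that the upper face of the box is not reached.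
It is not: if `Δ k t = B`, then the total at each later round `τ` is at least `θ ^ (τ - t - 1) B`,
so the marginal gain is at most `T R / B`, which is less than `2 α_k B` when `B` is large.
-/

namespace DUFL

variable {N T : ℕ}

/-! ### Volumes as affine functions of the strategy -/

lemma volume_add_smul (θ d s : ℝ) (Δ v : Fin T → ℝ) (t : ℕ) :
    volume θ d (fun i => Δ i + s * v i) t = volume θ d Δ t + s * volume θ 0 v t := by
  induction t with
  | zero => simp [volume]
  | succ t ih =>
    simp only [volume, ih]
    split_ifs <;> ring

lemma volume_nonneg {θ d : ℝ} (hθ : 0 ≤ θ) (hd : 0 ≤ d) {Δ : Fin T → ℝ} (hΔ : ∀ i, 0 ≤ Δ i)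
    (t : ℕ) : 0 ≤ volume θ d Δ t := by
  induction t with
  | zero => exact hd
  | succ t ih =>
    simp only [volume]
    split_ifs with h
    · exact add_nonneg (mul_nonneg hθ ih) (hΔ _)
    · simpa using mul_nonneg hθ ih

lemma pow_mul_le_volume {θ d : ℝ} (hθ : 0 ≤ θ) {Δ : Fin T → ℝ} (hΔ : ∀ i, 0 ≤ Δ i)
    (t : ℕ) : θ ^ t * d ≤ volume θ d Δ t := by
  induction t with
  | zero => simp [volume]
  | succ t ih =>
    simp only [volume]
    have := mul_le_mul_of_nonneg_left ih hθ
    have h0 : 0 ≤ if h : t < T then Δ ⟨t, h⟩ else 0 := by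
      split_ifs
      · exact hΔ _
      · exact le_rfl
    rw [pow_succ']
    linarith

/-- An increment collected at round `i` is still present at round `t > i`, discounted by
`θ ^ (t - i - 1)`. -/
lemma pow_mul_increment_le_volume {θ d : ℝ} (hθ : 0 ≤ θ) (hd : 0 ≤ d) {Δ : Fin T → ℝ}
    (hΔ : ∀ i, 0 ≤ Δ i) (i : Fin T) {t : ℕ} (ht : (i : ℕ) < t) :
    θ ^ (t - (i : ℕ) - 1) * Δ i ≤ volume θ d Δ t := by
  induction t, ht using Nat.le_induction with
  | base =>
    simp only [volume, i.2, dif_pos, Fin.eta]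
    have := mul_nonneg hθ (volume_nonneg hθ hd hΔ i)
    simpa using this
  | succ t ht ih =>
    have h0 : 0 ≤ if h : t < T then Δ ⟨t, h⟩ else 0 := by
      split_ifs
      · exact hΔ _
      · exact le_rfl
    have e : t + 1 - (i : ℕ) - 1 = (t - (i : ℕ) - 1) + 1 := by omega
    simp only [volume]
    rw [e, pow_succ']
    have := mul_le_mul_of_nonneg_left ih hθ
    linarith

lemma volume_zero_eq_sum (θ : ℝ) (v : Fin T → ℝ) (t : ℕ) :
    volume θ 0 v t = ∑ i : Fin T, if (i : ℕ) < t then θ ^ (t - (i : ℕ) - 1) * v i else 0 := by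
  induction t with
  | zero => simp [volume]
  | succ t ih =>
    have hlast : (if h : t < T then v ⟨t, h⟩ else 0)
        = ∑ i : Fin T, if (i : ℕ) = t then v i else 0 := by
      split_ifs with h
      · rw [Finset.sum_eq_single ⟨t, h⟩]
        · simp
        · intro b _ hb
          exact if_neg fun hbt => hb (Fin.ext hbt)
        · simp
      · exact (Finset.sum_eq_zero fun i _ => if_neg (by have := i.2; omega)).symm
    simp only [volume]
    rw [ih, hlast, Finset.mul_sum, ← Finset.sum_add_distrib]
    refine Finset.sum_congr rfl fun i _ => ?_
    rcases lt_trichotomy (i : ℕ) t with h | h | h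
    · have e : t + 1 - (i : ℕ) - 1 = (t - (i : ℕ) - 1) + 1 := by omega
      rw [if_pos h, if_neg h.ne, if_pos (by omega), e, pow_succ']
      ring
    · subst h
      simp
    · rw [if_neg (by omega), if_neg (by omega), if_neg (by omega)]
      simp

/-- Exchanging the order of summation: the backward discounted sum is adjoint to `v ↦ volume θ 0 v`. -/
lemma sum_volume_zero_mul (θ : ℝ) (v a : Fin T → ℝ) :
    ∑ τ : Fin T, volume θ 0 v τ * a τ
      = ∑ t : Fin T, v t * ∑ τ ∈ Finset.Ioi t, θ ^ ((τ : ℕ) - (t : ℕ) - 1) * a τ := by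
  simp only [volume_zero_eq_sum, Finset.sum_mul, Finset.mul_sum]
  rw [Finset.sum_comm]
  refine Finset.sum_congr rfl fun t _ => ?_
  have : Finset.Ioi t = Finset.univ.filter fun τ : Fin T => (t : ℕ) < τ := by
    ext τ
    rw [Finset.mem_Ioi, Fin.lt_def, Finset.mem_filter_univ]
  rw [this, Finset.sum_filter]
  refine Finset.sum_congr rfl fun τ _ => ?_
  split_ifs <;> ring

lemma continuous_volume (θ d : ℝ) (t : ℕ) :
    Continuous fun Δ : Fin T → ℝ => volume θ d Δ t := by
  induction t with
  | zero => exact continuous_const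
  | succ t ih =>
    simp only [volume]
    split_ifs
    · exact (continuous_const.mul ih).add (continuous_apply _)
    · exact (continuous_const.mul ih).add continuous_const

/-! ### Optimality of the increment formula for a given estimator -/

/-- The derivative of client `k`'s utility in its increment at round `t`, without the contribution
of the collection cost, when its volumes are `d`. -/
noncomputable def marginalGain (p : Params N) (φ : Fin T → ℝ) (k : Fin N) (d : Fin T → ℝ) (t : Fin T) : ℝ :=
  ∑ τ ∈ Finset.Ioi t, p.θ ^ ((τ : ℕ) - (t : ℕ) - 1) * (p.R / φ τ - 2 * p.β k * d τ)

lemma increment_eq (p : Params N) (φ : Fin T → ℝ) (k : Fin N) (d : Fin T → ℝ) (t : Fin T) :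
    increment p φ k d t = max (1 / (2 * p.α k) * marginalGain p φ k d t) 0 := rfl

/-- A strategy that satisfies the increment formula for its own volumes is optimal: the utility is
concave, and the formula says that the first order conditions hold. -/
lemma isOptimalStrategy_of_eq_increment (p : Params N) (φ : Fin T → ℝ) (k : Fin N)
    (hα : 0 < p.α k) (hβ : 0 ≤ p.β k) (Δ : Fin T → ℝ)
    (hΔ : Δ = increment p φ k fun t => volume p.θ (p.D₀ k) Δ t) :
    IsOptimalStrategy p φ k Δ := by
  refine ⟨fun Δ' hΔ' => ?_, fun t => by rw [hΔ]; exact le_max_right _ _⟩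
  simp only [Set.mem_ofPred_eq] at hΔ' ⊢
  set v : Fin T → ℝ := fun t => Δ' t - Δ t with hv
  set g := marginalGain p φ k fun t => volume p.θ (p.D₀ k) Δ t with hg
  have hD : ∀ t : ℕ, volume p.θ (p.D₀ k) Δ' t
      = volume p.θ (p.D₀ k) Δ t + volume p.θ 0 v t := by
    intro t
    have := volume_add_smul p.θ (p.D₀ k) 1 Δ v t
    simpa [hv] using this
  have hadj := sum_volume_zero_mul p.θ v
    fun τ => p.R / φ τ - 2 * p.β k * volume p.θ (p.D₀ k) Δ τ
  have hfirst : ∀ t, v t * g t - 2 * p.α k * Δ t * v t ≤ 0 := by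
    intro t
    have ht : Δ t = max (1 / (2 * p.α k) * g t) 0 := congrFun hΔ t
    have e : g t = 2 * p.α k * (1 / (2 * p.α k) * g t) := by field_simp
    have hle : g t ≤ 2 * p.α k * Δ t := by
      rw [e, ht]
      exact mul_le_mul_of_nonneg_left (le_max_left _ _) (by positivity)
    have hcompl : Δ t * (g t - 2 * p.α k * Δ t) = 0 := by
      rcases max_choice (1 / (2 * p.α k) * g t) 0 with h | h
      · rw [ht, h, ← e]
        ring
      · rw [ht, h, zero_mul]
    have := mul_nonneg (hΔ' t) (sub_nonneg.2 hle)
    simp only [hv]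
    nlinarith
  have hterm : utility p φ k Δ' ≤ utility p φ k Δ
      + ∑ t : Fin T, (volume p.θ 0 v t * (p.R / φ t - 2 * p.β k * volume p.θ (p.D₀ k) Δ t)
        - 2 * p.α k * Δ t * v t) := by
    unfold utility
    rw [← Finset.sum_add_distrib]
    refine Finset.sum_le_sum fun t _ => ?_
    rw [hD t]
    have e : Δ' t = Δ t + v t := by simp [hv]
    rw [e]
    have h1 := mul_nonneg hα.le (sq_nonneg (v t))
    have h2 := mul_nonneg hβ (sq_nonneg (volume p.θ 0 v t))
    have e2 : (volume p.θ (p.D₀ k) Δ t + volume p.θ 0 v t) / φ t * p.R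
        = volume p.θ (p.D₀ k) Δ t / φ t * p.R + volume p.θ 0 v t * (p.R / φ t) := by ring
    rw [e2]
    nlinarith
  refine hterm.trans ?_
  rw [Finset.sum_sub_distrib, hadj, ← Finset.sum_sub_distrib]
  have := Finset.sum_nonpos fun t (_ : t ∈ Finset.univ) => hfirst t
  simp only [hg, marginalGain] at this
  linarith

/-! ### The potential of the clients' game -/

/-- The matrix of volumes produced by the strategies `x`. -/
def volumes (p : Params N) (x : Fin N → Fin T → ℝ) : Fin N → Fin T → ℝ :=
  fun k t => volume p.θ (p.D₀ k) (x k) t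

/-- The total cost of data collection and training. -/
noncomputable def cost (p : Params N) (x : Fin N → Fin T → ℝ) : ℝ :=
  ∑ k, ∑ t, (p.α k * x k t ^ 2 + p.β k * volumes p x k t ^ 2)

/-- The potential of the game in which the estimator is the actual total volume. Meaningful only
when all total volumes are positive. -/
noncomputable def potential (p : Params N) (x : Fin N → Fin T → ℝ) : ℝ :=
  ∑ t, p.R * Real.log (total (volumes p x) t) - cost p x

/-- The exponential of the potential, extended continuously to strategies for which some total
volume vanishes. -/
noncomputable def expPotential (p : Params N) (x : Fin N → Fin T → ℝ) : ℝ :=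
  (∏ t, total (volumes p x) t ^ p.R) * Real.exp (-cost p x)

lemma expPotential_eq (p : Params N) {x : Fin N → Fin T → ℝ}
    (hx : ∀ t, 0 < total (volumes p x) t) : expPotential p x = Real.exp (potential p x) := by
  unfold expPotential potential
  rw [sub_eq_add_neg, Real.exp_add, Real.exp_sum]
  congr 1
  refine Finset.prod_congr rfl fun t _ => ?_
  rw [Real.rpow_def_of_pos (hx t), mul_comm]

lemma continuous_volumes (p : Params N) (k : Fin N) (t : Fin T) :
    Continuous fun x : Fin N → Fin T → ℝ => volumes p x k t :=
  (continuous_volume _ _ _).comp (continuous_apply k)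

lemma continuous_expPotential (p : Params N) (hR : 0 ≤ p.R) :
    Continuous (expPotential p : (Fin N → Fin T → ℝ) → ℝ) := by
  unfold expPotential
  refine Continuous.mul (continuous_finsetProd _ fun t _ => ?_) (Real.continuous_exp.comp ?_)
  · exact (continuous_finsetSum _ fun k _ => continuous_volumes p k t).rpow_const
      fun _ => Or.inr hR
  · refine Continuous.neg (continuous_finsetSum _ fun k _ => continuous_finsetSum _ fun t _ => ?_)
    have := continuous_volumes p k t
    fun_prop

/-- The potential has a maximizer among the strategies in a box that keep all totals positive. -/
lemma exists_potential_maximizer (p : Params N) (hR : 0 ≤ p.R) (hθ : 0 ≤ p.θ)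
    (hRθ : 0 < p.R ∨ 0 < p.θ) (hD₀ : ∀ k, 0 ≤ p.D₀ k) (hD₀_pos : 0 < ∑ k, p.D₀ k)
    {B : ℝ} (hB : 0 < B) :
    ∃ x : Fin N → Fin T → ℝ, (∀ k t, x k t ∈ Set.Icc 0 B) ∧ (∀ t, 0 < total (volumes p x) t) ∧
      ∀ y : Fin N → Fin T → ℝ, (∀ k t, y k t ∈ Set.Icc 0 B) →
        (∀ t, 0 < total (volumes p y) t) → potential p y ≤ potential p x := by
  have hK : IsCompact (Set.Icc (0 : Fin N → Fin T → ℝ) fun _ _ => B) := isCompact_Icc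
  have hmem : ∀ x : Fin N → Fin T → ℝ,
      (x ∈ Set.Icc (0 : Fin N → Fin T → ℝ) fun _ _ => B) ↔ ∀ k t, x k t ∈ Set.Icc 0 B := by
    intro x
    simp only [Set.mem_Icc, Pi.le_def, Pi.zero_apply]
    exact ⟨fun h k t => ⟨h.1 k t, h.2 k t⟩, fun h => ⟨fun k t => (h k t).1, fun k t => (h k t).2⟩⟩
  have hne : (fun _ _ => B) ∈ Set.Icc (0 : Fin N → Fin T → ℝ) fun _ _ => B :=
    (hmem _).2 fun _ _ => ⟨hB.le, le_rfl⟩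
  obtain ⟨x, hx, hmax⟩ := hK.exists_isMaxOn ⟨_, hne⟩ (continuous_expPotential p hR).continuousOn
  have hx' := (hmem x).1 hx
  obtain ⟨k₀, -, -⟩ := Finset.exists_ne_zero_of_sum_ne_zero hD₀_pos.ne'
  have hpos : ∀ t, 0 < total (volumes p x) t := by
    intro t
    have hnn : 0 ≤ total (volumes p x) t :=
      Finset.sum_nonneg fun k _ => volume_nonneg hθ (hD₀ k) (fun i => (hx' k i).1) _
    rcases hRθ with hR' | hθ'
    · -- Compare with the strategies that are constantly `B`, where all totals are positive.
      have hcmp : ∀ t, 0 < total (volumes p fun _ (_ : Fin T) => B) t := by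
        intro t
        have hn : ∀ k ∈ Finset.univ, 0 ≤ volumes p (fun _ (_ : Fin T) => B) k t := fun k _ =>
          volume_nonneg hθ (hD₀ k) (fun _ => hB.le) _
        rcases t with ⟨_ | s, hs⟩
        · exact hD₀_pos
        · refine Finset.sum_pos' hn ⟨k₀, Finset.mem_univ _, ?_⟩
          have := pow_mul_increment_le_volume (T := T) hθ (hD₀ k₀) (Δ := fun _ => B)
            (fun _ => hB.le) ⟨s, by omega⟩ (t := s + 1) (by simp)
          simp only [volumes]
          refine lt_of_lt_of_le ?_ this
          simpa using hB
      have h1 : 0 < expPotential p x := by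
        refine lt_of_lt_of_le ?_ (hmax hne)
        rw [expPotential_eq p hcmp]
        exact Real.exp_pos _
      refine lt_of_le_of_ne hnn fun h0 => h1.ne' ?_
      unfold expPotential
      rw [Finset.prod_eq_zero (Finset.mem_univ t), zero_mul]
      rw [← h0, Real.zero_rpow hR'.ne']
    · have h1 : p.θ ^ (t : ℕ) * ∑ k, p.D₀ k ≤ total (volumes p x) t := by
        rw [Finset.mul_sum]
        exact Finset.sum_le_sum fun k _ => pow_mul_le_volume hθ (fun i => (hx' k i).1) _
      exact lt_of_lt_of_le (by positivity) h1
  refine ⟨x, hx', hpos, fun y hy hypos => ?_⟩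
  have := hmax ((hmem y).2 hy)
  simp only [Set.mem_ofPred_eq] at this
  rwa [expPotential_eq p hpos, expPotential_eq p hypos, Real.exp_le_exp] at this

lemma hasDerivAt_potential (p : Params N) (x v : Fin N → Fin T → ℝ)
    (hx : ∀ t, 0 < total (volumes p x) t) :
    HasDerivAt (fun s : ℝ => potential p fun k t => x k t + s * v k t)
      (∑ k, ∑ t, v k t * (marginalGain p (total (volumes p x)) k (volumes p x k) t
        - 2 * p.α k * x k t)) 0 := by
  set φ := total (volumes p x) with hφ
  set V : Fin N → Fin T → ℝ := fun k t => volume p.θ 0 (v k) t with hV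
  have hvol : ∀ (s : ℝ) k t,
      volumes p (fun k t => x k t + s * v k t) k t = volumes p x k t + s * V k t :=
    fun s k t => volume_add_smul _ _ _ _ _ _
  have htot : ∀ (s : ℝ) t,
      total (volumes p fun k t => x k t + s * v k t) t = φ t + s * ∑ k, V k t := by
    intro s t
    simp only [total, hφ, hvol, Finset.sum_add_distrib, Finset.mul_sum]
  have haff : ∀ a b : ℝ, HasDerivAt (fun s : ℝ => a + s * b) b 0 := fun a b => by
    simpa using ((hasDerivAt_id (0 : ℝ)).mul_const b).const_add a
  have hlog : HasDerivAt (fun s : ℝ => ∑ t, p.R * Real.log (φ t + s * ∑ k, V k t))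
      (∑ t, p.R * ((∑ k, V k t) / φ t)) 0 := by
    refine HasDerivAt.fun_sum fun t _ => HasDerivAt.const_mul _ ?_
    simpa using (haff (φ t) (∑ k, V k t)).log (by simpa using (hx t).ne')
  have hcost : HasDerivAt (fun s : ℝ => ∑ k, ∑ t, (p.α k * (x k t + s * v k t) ^ 2
      + p.β k * (volumes p x k t + s * V k t) ^ 2))
      (∑ k, ∑ t, (p.α k * (2 * x k t * v k t) + p.β k * (2 * volumes p x k t * V k t))) 0 := by
    refine HasDerivAt.fun_sum fun k _ => HasDerivAt.fun_sum fun t _ => HasDerivAt.add ?_ ?_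
    · simpa using ((haff (x k t) (v k t)).fun_pow 2).const_mul (p.α k)
    · simpa using ((haff (volumes p x k t) (V k t)).fun_pow 2).const_mul (p.β k)
  have h := hlog.sub hcost
  unfold potential cost
  simp only [htot, hvol]
  refine h.congr_deriv ?_
  have hswap : ∑ t, p.R * ((∑ k, V k t) / φ t) = ∑ k, ∑ t, V k t * (p.R / φ t) := by
    rw [Finset.sum_comm]
    refine Finset.sum_congr rfl fun t _ => ?_
    rw [← Finset.sum_mul]
    ring
  rw [hswap, ← Finset.sum_sub_distrib]
  refine Finset.sum_congr rfl fun k _ => ?_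
  have hadj := sum_volume_zero_mul p.θ (v k)
    fun τ => p.R / φ τ - 2 * p.β k * volumes p x k τ
  simp only [mul_sub (v k _), marginalGain]
  rw [Finset.sum_sub_distrib, ← hadj, ← Finset.sum_sub_distrib, ← Finset.sum_sub_distrib]
  refine Finset.sum_congr rfl fun t _ => ?_
  simp only [hV]
  ring

/-- First order conditions at a maximizer of the potential on a box. -/
lemma potential_variational_inequality (p : Params N) {B : ℝ} (x : Fin N → Fin T → ℝ)
    (hθ : 0 ≤ p.θ) (hD₀ : ∀ k, 0 ≤ p.D₀ k)
    (hxB : ∀ k t, x k t ∈ Set.Icc 0 B) (hx : ∀ t, 0 < total (volumes p x) t)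
    (hmax : ∀ y : Fin N → Fin T → ℝ, (∀ k t, y k t ∈ Set.Icc 0 B) →
        (∀ t, 0 < total (volumes p y) t) → potential p y ≤ potential p x)
    (y : Fin N → Fin T → ℝ) (hy : ∀ k t, y k t ∈ Set.Icc 0 B) :
    ∑ k, ∑ t, (y k t - x k t) * (marginalGain p (total (volumes p x)) k (volumes p x k) t
        - 2 * p.α k * x k t) ≤ 0 := by
  have hderiv := hasDerivAt_potential p x (fun k t => y k t - x k t) hx
  refine le_of_tendsto hderiv.tendsto_slope_zero_right ?_
  filter_upwards [Ioo_mem_nhdsGT (zero_lt_one (α := ℝ))] with s hs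
  have hle : potential p (fun k t => x k t + s * (y k t - x k t)) ≤ potential p x := by
    have hbox : ∀ k t, x k t + s * (y k t - x k t) ∈ Set.Icc 0 B := fun k t =>
      (convex_Icc (0 : ℝ) B).add_smul_sub_mem (hxB k t) (hy k t) ⟨hs.1.le, hs.2.le⟩
    refine hmax _ hbox fun t => ?_
    -- The total along the segment is the convex combination of a positive and a nonnegative one.
    have htot : total (volumes p fun k t => x k t + s * (y k t - x k t)) t
        = (1 - s) * total (volumes p x) t + s * total (volumes p y) t := by
      simp only [total, Finset.mul_sum, ← Finset.sum_add_distrib]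
      refine Finset.sum_congr rfl fun k _ => ?_
      have h1 := volume_add_smul p.θ (p.D₀ k) s (x k) (fun t => y k t - x k t) t
      have h2 := volume_add_smul p.θ (p.D₀ k) 1 (x k) (fun t => y k t - x k t) t
      simp only [one_mul, add_sub_cancel] at h2
      simp only [volumes]
      change volume p.θ (p.D₀ k) (y k) t = _ at h2
      rw [h1, h2]
      ring
    rw [htot]
    have h1 := mul_pos (sub_pos.2 hs.2) (hx t)
    have h2 : 0 ≤ total (volumes p y) t :=
      Finset.sum_nonneg fun k _ => volume_nonneg hθ (hD₀ k) (fun i => (hy k i).1) _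
    have := mul_nonneg hs.1.le h2
    linarith
  simp only [zero_add, zero_mul, add_zero, smul_eq_mul]
  exact mul_nonpos_of_nonneg_of_nonpos (inv_nonneg.2 hs.1.le) (sub_nonpos.2 hle)

/-- If the box is large enough, the first order conditions on it are the increment formula. -/
lemma eq_increment_of_variational_inequality (p : Params N) {B : ℝ} (hB : 0 < B)
    (x : Fin N → Fin T → ℝ) (hR : 0 ≤ p.R) (hθ : 0 ≤ p.θ) (hα : ∀ k, 0 < p.α k)
    (hβ : ∀ k, 0 ≤ p.β k) (hD₀ : ∀ k, 0 ≤ p.D₀ k) (hBα : ∀ k, T * p.R < 2 * p.α k * B ^ 2)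
    (hxB : ∀ k t, x k t ∈ Set.Icc 0 B) (hx : ∀ t, 0 < total (volumes p x) t)
    (hvi : ∀ y : Fin N → Fin T → ℝ, (∀ k t, y k t ∈ Set.Icc 0 B) →
      ∑ k, ∑ t, (y k t - x k t) * (marginalGain p (total (volumes p x)) k (volumes p x k) t
        - 2 * p.α k * x k t) ≤ 0) (k : Fin N) :
    x k = increment p (total (volumes p x)) k (volumes p x k) := by
  set φ := total (volumes p x) with hφ
  funext t
  rw [increment_eq]
  set g := marginalGain p φ k (volumes p x k) t with hg
  have hαk := hα k
  -- Vary a single increment.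
  have hone : ∀ z ∈ Set.Icc 0 B, (z - x k t) * (g - 2 * p.α k * x k t) ≤ 0 := by
    intro z hz
    have h := hvi (fun k' t' => if k' = k ∧ t' = t then z else x k' t') fun k' t' => by
      split_ifs
      exacts [hz, hxB k' t']
    rwa [Finset.sum_eq_single k, Finset.sum_eq_single t, if_pos ⟨rfl, rfl⟩] at h
    · intro t' _ ht'
      simp [ht']
    · simp
    · intro k' _ hk'
      simp [hk']
    · simp
  have hvol : ∀ k' t', 0 ≤ volumes p x k' t' := fun k' t' =>
    volume_nonneg hθ (hD₀ k') (fun i => (hxB k' i).1) _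
  have hlt : x k t < B := by
    refine lt_of_le_of_ne (hxB k t).2 fun hxt => ?_
    have hge : 2 * p.α k * B ≤ g := by
      have := hone 0 ⟨le_rfl, hB.le⟩
      rw [hxt] at this
      by_contra! hcon
      nlinarith
    have hle : g ≤ T * (p.R / B) := by
      have hsum : g ≤ ∑ τ ∈ Finset.Ioi t, p.R / B := by
        refine Finset.sum_le_sum fun τ hτ => ?_
        have hτ' : (t : ℕ) < τ := Fin.lt_def.1 (Finset.mem_Ioi.1 hτ)
        have hc : 0 ≤ p.θ ^ ((τ : ℕ) - (t : ℕ) - 1) := pow_nonneg hθ _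
        have h1 : p.θ ^ ((τ : ℕ) - (t : ℕ) - 1) * B ≤ φ τ := by
          have h2 := pow_mul_increment_le_volume hθ (hD₀ k) (fun i => (hxB k i).1) t hτ'
          rw [hxt] at h2
          exact h2.trans (Finset.single_le_sum (f := fun k' => volumes p x k' τ)
            (fun k' _ => hvol k' τ) (Finset.mem_univ k))
        have h3 : p.θ ^ ((τ : ℕ) - (t : ℕ) - 1) * (p.R / φ τ) ≤ p.R / B := by
          rw [← mul_div_assoc, div_le_div_iff₀ (hx τ) hB]
          nlinarith
        have h4 := mul_nonneg hc (mul_nonneg (mul_nonneg zero_le_two (hβ k)) (hvol k τ))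
        rw [mul_sub]
        linarith
      refine hsum.trans ?_
      rw [Finset.sum_const, nsmul_eq_mul]
      refine mul_le_mul_of_nonneg_right ?_ (div_nonneg hR hB.le)
      exact_mod_cast (Finset.card_le_univ _).trans_eq (Fintype.card_fin T)
    have h5 : 2 * p.α k * B * B ≤ T * p.R := by
      have h6 := mul_le_mul_of_nonneg_right (hge.trans hle) hB.le
      have e : T * (p.R / B) * B = T * p.R := by field_simp
      linarith
    have := hBα k
    nlinarith
  have hle : g ≤ 2 * p.α k * x k t := by
    have := hone B ⟨hB.le, le_rfl⟩
    by_contra! hcon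
    nlinarith [mul_pos (sub_pos.2 hlt) (sub_pos.2 hcon)]
  have e : 1 / (2 * p.α k) * g = g / (2 * p.α k) := by ring
  rw [e]
  rcases (hxB k t).1.eq_or_lt with h0 | h0
  · rw [← h0] at hle ⊢
    rw [max_eq_right]
    exact div_nonpos_of_nonpos_of_nonneg (by linarith) (by linarith)
  · have hge : 2 * p.α k * x k t ≤ g := by
      have := hone 0 ⟨le_rfl, hB.le⟩
      by_contra! hcon
      nlinarith [mul_pos h0 (sub_pos.2 hcon)]
    have hxg : x k t = g / (2 * p.α k) := by
      rw [eq_div_iff (by positivity)]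
      linarith
    rw [← hxg, max_eq_left h0.le]

end DUFL

/-! ### Existence of the fixed point -/

theorem proposition2 {N T : ℕ} (p : DUFL.Params N)
    (hR : 0 ≤ p.R) (hθ₀ : 0 ≤ p.θ) (hθ₁ : p.θ ≤ 1) (hRθ : 0 < p.R ∨ 0 < p.θ)
    (hα : ∀ k, 0 < p.α k) (hβ : ∀ k, 0 ≤ p.β k)
    (hD₀ : ∀ k, 0 ≤ p.D₀ k) (hD₀_pos : 0 < ∑ k, p.D₀ k) :
    ∃ (φ : Fin T → ℝ) (D : Fin N → Fin T → ℝ) (U : ℝ),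
      (∀ t, 0 < φ t) ∧ DUFL.IsFixedEstimator p φ ∧
      (∀ k t, D k t ∈ Set.Icc 0 U) ∧ DUFL.Psi p D = D ∧ φ = DUFL.total D ∧
      (∀ k, DUFL.IsOptimalStrategy p φ k (DUFL.increment p φ k (D k))) := by
  open DUFL in
  -- A size of the box with `B ^ 2 ≥ B > T R / (2 α_k)` for all `k`.
  set B : ℝ := 1 + ∑ k, T * p.R / (2 * p.α k) with hBdef
  have hnn : ∀ k ∈ Finset.univ, 0 ≤ T * p.R / (2 * p.α k) := fun k _ =>
    div_nonneg (mul_nonneg (Nat.cast_nonneg T) hR) (by have := hα k; positivity)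
  have hB1 : 1 ≤ B := le_add_of_nonneg_right (Finset.sum_nonneg hnn)
  have hB : 0 < B := by linarith
  have hBα : ∀ k, T * p.R < 2 * p.α k * B ^ 2 := by
    intro k
    have hαk := hα k
    have h1 : T * p.R / (2 * p.α k) < B := by
      have := Finset.single_le_sum hnn (Finset.mem_univ k)
      linarith
    rw [div_lt_iff₀ (by positivity)] at h1
    nlinarith [mul_nonneg hαk.le (mul_nonneg hB.le (sub_nonneg.2 hB1))]
  obtain ⟨x, hxB, hx, hmax⟩ :=
    exists_potential_maximizer (T := T) p hR hθ₀ hRθ hD₀ hD₀_pos hB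
  have hinc := eq_increment_of_variational_inequality p hB x hR hθ₀ hα hβ hD₀ hBα hxB hx
    (potential_variational_inequality p x hθ₀ hD₀ hxB hx hmax)
  have hopt : ∀ k, IsOptimalStrategy p (total (volumes p x)) k
      (increment p (total (volumes p x)) k (volumes p x k)) := fun k => by
    rw [← hinc k]
    exact isOptimalStrategy_of_eq_increment p _ k (hα k) (hβ k) _ (hinc k)
  have hnonneg : ∀ k t, 0 ≤ volumes p x k t := fun k t =>
    volume_nonneg hθ₀ (hD₀ k) (fun i => (hxB k i).1) _
  refine ⟨total (volumes p x), volumes p x, ∑ k, ∑ t, volumes p x k t, hx,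
    ⟨x, fun k => ?_, fun t => rfl⟩, fun k t => ⟨hnonneg k t, ?_⟩, ?_, rfl, hopt⟩
  · rw [hinc k]
    exact hopt k
  · calc volumes p x k t ≤ ∑ t, volumes p x k t :=
          Finset.single_le_sum (fun t _ => hnonneg k t) (Finset.mem_univ t)
      _ ≤ _ := Finset.single_le_sum (f := fun k => ∑ t, volumes p x k t)
          (fun k _ => Finset.sum_nonneg fun t _ => hnonneg k t) (Finset.mem_univ k)
  · funext k t
    simp only [Psi, ← hinc k]
    rfl
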